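/- All logarithms are to base 2. Let $n\ge 1$ and $\tau\ge 1$ be integers, and let $a_1,\dots,a_n,b_1,\dots,b_n$ be nonnegative integers of bitsize at most $\tau$, that is, $a_i,b_i\le 2^\tau$. Let $\mathcal K=\langle X_1^2-a_1,\dots,X_n^2-a_n,\,Y_1^2-b_1,\dots,Y_n^2-b_n\rangle$ and let $V_{\mathbb C}(\mathcal K)\subset\mathbb C^{2n}$ be its set of complex zeros $(\boldsymbol x,\boldsymbol y)$. Let $r(n,\tau)$ be the minimum positive value of $\bigl|\sum_{i=1}^n\sqrt{a_i}-\sum_{i=1}^n\sqrt{b_i}\bigr|$ over all such $a_i,b_i$. Here $\widetilde{\mathcal O}(n2^{2n}\tau)$ stands for a quantity of absolute value at most $C\,n\,2^{2n}\,\tau\,\bigl(\log(n+\tau+2)\bigr)^{k}$. There are absolute constants $C$ and $k$ such that, for all $n$, $\tau$, $a_i$, $b_i$ as above, $$\sum_{\substack{(\boldsymbol x,\boldsymbol y)\in V_{\mathbb C}(\mathcal K)\\ \sum x_i\neq\sum y_i}}\Bigl|\log\Bigl|\sum_{i=1}^n x_i-\sum_{i=1}^n y_i\Bigr|\Bigr|\in\widetilde{\mathcal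 O}(n2^{2n}\tau),$$ and the same bound holds for the sum over all $2^{2n}$ sign choices $x_i=\pm\sqrt{a_i}$, $y_i=\pm\sqrt{b_i}$ (again over those with $\sum x_i\ne\sum y_i$), in which a zero of $\mathcal K$ occurs once for each sign choice that yields it. Moreover, the minimum $r(n,\tau)$ exists, and $$-\log r(n,\tau)\in\widetilde{\mathcal O}(n\tau2^{2n}).$$ -/

import Mathlib

namespace SqrtSum

/-- The ideal `K = ⟨X₁² - a₁, …, Xₙ² - aₙ, Y₁² - b₁, …, Yₙ² - bₙ⟩` of
`ℂ[X₁, …, Xₙ, Y₁, …, Yₙ]`; the variable `Xᵢ` is `Sum.inl i` and `Yᵢ` is `Sum.inr i`. -/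
noncomputable def sqIdeal {n : ℕ} (a b : Fin n → ℕ) :
    Ideal (MvPolynomial (Fin n ⊕ Fin n) ℂ) :=
  Ideal.span
    (Set.range (fun i : Fin n =>
        MvPolynomial.X (Sum.inl i) ^ 2 - MvPolynomial.C ((a i : ℕ) : ℂ)) ∪
      Set.range (fun i : Fin n =>
        MvPolynomial.X (Sum.inr i) ^ 2 - MvPolynomial.C ((b i : ℕ) : ℂ)))

/-- The complex variety of `K`, a set of points `(x, y) ∈ ℂⁿ × ℂⁿ`. -/
def sqVariety {n : ℕ} (a b : Fin n → ℕ) : Set (Fin n ⊕ Fin n → ℂ) :=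
  MvPolynomial.zeroLocus ℂ (sqIdeal a b)

theorem mem_sqVariety {n : ℕ} {a b : Fin n → ℕ} {z : Fin n ⊕ Fin n → ℂ} :
    z ∈ sqVariety a b ↔
      (∀ i, z (Sum.inl i) ^ 2 = (a i : ℂ)) ∧ (∀ i, z (Sum.inr i) ^ 2 = (b i : ℂ)) := by
  rw [sqVariety, sqIdeal, MvPolynomial.zeroLocus_span]
  simp [sub_eq_zero, or_imp, forall_and]

theorem sqVariety_finite {n : ℕ} (a b : Fin n → ℕ) : (sqVariety a b).Finite := by
  have hfin : ∀ c : ℂ, {w : ℂ | w ^ 2 = c}.Finite := by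
    intro c
    obtain ⟨s, hs⟩ := IsAlgClosed.exists_pow_nat_eq c (n := 2) (by norm_num)
    refine (Set.toFinite ({s, -s} : Set ℂ)).subset ?_
    intro w hw
    have : w ^ 2 = s ^ 2 := by rw [hs]; exact hw
    simpa using sq_eq_sq_iff_eq_or_eq_neg.mp this
  have h : (Set.pi Set.univ
      (fun j : Fin n ⊕ Fin n => {w : ℂ | w ^ 2 = Sum.elim (fun i => (a i : ℂ))
        (fun i => (b i : ℂ)) j})).Finite := Set.Finite.pi' (fun j => hfin _) |>.subset
          (fun z hz j => hz j (Set.mem_univ j))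
  refine h.subset ?_
  intro z hz
  obtain ⟨h1, h2⟩ := mem_sqVariety.mp hz
  rintro (i | i) -
  · exact h1 i
  · exact h2 i

/-- The difference `∑ᵢ xᵢ - ∑ᵢ yᵢ` at a point `(x, y)`. -/
noncomputable def diffAt {n : ℕ} (z : Fin n ⊕ Fin n → ℂ) : ℂ :=
  ∑ i, z (Sum.inl i) - ∑ i, z (Sum.inr i)

open Classical in
/-- The sum of `|log₂ |∑ᵢ xᵢ - ∑ᵢ yᵢ||` over the points `(x, y)` of the variety of `K` at which
the difference is nonzero. -/
noncomputable def varietyLogSum {n : ℕ} (a b : Fin n → ℕ) : ℝ :=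
  ∑ z ∈ (sqVariety_finite a b).toFinset with diffAt z ≠ 0, |Real.logb 2 ‖diffAt z‖|

/-- The difference `∑ᵢ εᵢ √aᵢ - ∑ᵢ δᵢ √bᵢ` for a choice of signs `ε, δ ∈ {1, -1}ⁿ`. -/
noncomputable def signDiff {n : ℕ} (a b : Fin n → ℕ) (s : (Fin n → ℤˣ) × (Fin n → ℤˣ)) : ℝ :=
  ∑ i, ((s.1 i : ℤ) : ℝ) * √(a i : ℝ) - ∑ i, ((s.2 i : ℤ) : ℝ) * √(b i : ℝ)

open Classical in
/-- The same sum, taken over all `2 ^ (2 * n)` choices of signs with nonzero difference; a point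
of the variety is counted with its multiplicity (which exceeds one if some `aᵢ` or `bᵢ` is `0`). -/
noncomputable def signLogSum {n : ℕ} (a b : Fin n → ℕ) : ℝ :=
  ∑ s : (Fin n → ℤˣ) × (Fin n → ℤˣ) with signDiff a b s ≠ 0, |Real.logb 2 (|signDiff a b s|)|

/-- The positive values of `|∑ᵢ √aᵢ - ∑ᵢ √bᵢ|` for nonnegative integers `aᵢ, bᵢ` of
bitsize (base-2 logarithm) at most `τ`. -/
def positiveGaps (n τ : ℕ) : Set ℝ :=
  {d | 0 < d ∧ ∃ a b : Fin n → ℕ, (∀ i, a i ≤ 2 ^ τ) ∧ (∀ i, b i ≤ 2 ^ τ) ∧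
    d = |∑ i, √(a i : ℝ) - ∑ i, √(b i : ℝ)|}

/-- `r(n, τ)`, the minimum positive value of `|∑ᵢ √aᵢ - ∑ᵢ √bᵢ|`. -/
noncomputable def r (n τ : ℕ) : ℝ := sInf (positiveGaps n τ)

/-- `C · n 2^{2n} τ · log₂(n + τ + 2)^k`: a quantity depending on `n` and `τ` is in
`Õ(n 2^{2n} τ)` when some constants `C`, `k` make this an upper bound of its absolute value. -/
noncomputable def softBound (C : ℝ) (k n τ : ℕ) : ℝ :=
  C * ((n : ℝ) * 2 ^ (2 * n) * (τ : ℝ)) * Real.logb 2 ((n : ℝ) + (τ : ℝ) + 2) ^ k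

end SqrtSum

/-!
The polynomial `∏ₛ (X - dₛ)`, where `dₛ` runs over the `4 ^ n` signed differences
`∑ᵢ εᵢ √aᵢ - ∑ᵢ δᵢ √bᵢ`, has integer coefficients: replacing `f` by `f(X + √c) f(X - √c)` preserves
integrality, since the two factors have the shape `A + √c B` and `A - √c B` with `A`, `B` integral
(`prod_comp_sqrt_mem_lifts`), and the polynomial arises from `X` by `2 n` such steps. Its lowest
nonzero coefficient is, up to sign, the product of the nonzero `dₛ`, so this product has absolute
value at least `1` (`one_le_prod_abs_signDiff`).

On the other hand every `|dₛ|` is at most `2 ^ (n + τ)`. With `L = log₂ |dₛ|` this gives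
`|L| ≤ 2 (n + τ) - L`, and the sum of the `L` over the nonzero `dₛ` is nonnegative, so the sum of
the `|L|` is at most `4 ^ n * 2 (n + τ) ≤ 4 n τ 4 ^ n` (`signLogSum_le`). Thus `C = 4` suffices,
with no logarithmic factor. Each point of the variety comes from at least one choice of signs, and
each positive gap is one of the `|dₛ|`, so the other two bounds follow from this one.
-/

namespace SqrtSum

open Polynomial

/-! ### Integrality of the product over all signs -/

theorem exists_comp_add_sub_sqrt (f : ℤ[X]) (c : ℕ) :
    ∃ A B : ℤ[X],
      (f.map (Int.castRingHom ℝ)).comp (X + C (√(c : ℝ))) =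
        A.map (Int.castRingHom ℝ) + C (√(c : ℝ)) * B.map (Int.castRingHom ℝ) ∧
      (f.map (Int.castRingHom ℝ)).comp (X - C (√(c : ℝ))) =
        A.map (Int.castRingHom ℝ) - C (√(c : ℝ)) * B.map (Int.castRingHom ℝ) := by
  have hs : (C (√(c : ℝ)) : ℝ[X]) * C (√(c : ℝ)) = (c : ℝ[X]) := by
    rw [← C_mul, Real.mul_self_sqrt (Nat.cast_nonneg c)]
    simp
  induction f using Polynomial.induction_on with
  | C r => exact ⟨C r, 0, by simp, by simp⟩
  | add p q hp hq =>
    obtain ⟨A, B, h1, h2⟩ := hp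
    obtain ⟨A', B', h1', h2'⟩ := hq
    refine ⟨A + A', B + B', ?_, ?_⟩
    · simp only [Polynomial.map_add, add_comp, h1, h1']; ring
    · simp only [Polynomial.map_add, add_comp, h2, h2']; ring
  | monomial m r h =>
    obtain ⟨A, B, h1, h2⟩ := h
    refine ⟨A * X + (c : ℤ[X]) * B, A + B * X, ?_, ?_⟩
    · rw [pow_succ, ← mul_assoc, Polynomial.map_mul, mul_comp, h1]
      simp only [Polynomial.map_add, Polynomial.map_mul, map_X, X_comp, Polynomial.map_natCast]
      linear_combination (B.map (Int.castRingHom ℝ)) * hs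
    · rw [pow_succ, ← mul_assoc, Polynomial.map_mul, mul_comp, h2]
      simp only [Polynomial.map_add, Polynomial.map_mul, map_X, X_comp, Polynomial.map_natCast]
      linear_combination (B.map (Int.castRingHom ℝ)) * hs

theorem comp_sub_sqrt_mul_comp_add_sqrt_mem_lifts {f : ℝ[X]}
    (hf : f ∈ lifts (Int.castRingHom ℝ)) (c : ℕ) :
    f.comp (X - C (√(c : ℝ))) * f.comp (X + C (√(c : ℝ))) ∈ lifts (Int.castRingHom ℝ) := by
  obtain ⟨g, rfl⟩ := (mem_lifts _).1 hf
  obtain ⟨A, B, h1, h2⟩ := exists_comp_add_sub_sqrt g c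
  refine (mem_lifts _).2 ⟨A * A - (c : ℤ[X]) * (B * B), ?_⟩
  have hs : (C (√(c : ℝ)) : ℝ[X]) * C (√(c : ℝ)) = (c : ℝ[X]) := by
    rw [← C_mul, Real.mul_self_sqrt (Nat.cast_nonneg c)]
    simp
  rw [h1, h2]
  simp only [Polynomial.map_sub, Polynomial.map_mul, Polynomial.map_natCast]
  linear_combination (B.map (Int.castRingHom ℝ)) ^ 2 * hs

/-- The product of the translates of an integral polynomial by all signed sums of the `√aᵢ` is
integral. -/
theorem prod_comp_sqrt_mem_lifts {n : ℕ} (a : Fin n → ℕ) {f : ℝ[X]}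
    (hf : f ∈ lifts (Int.castRingHom ℝ)) :
    ∏ s : Fin n → ℤˣ, f.comp (X - C (∑ i, ((s i : ℤ) : ℝ) * √(a i : ℝ))) ∈
      lifts (Int.castRingHom ℝ) := by
  induction n generalizing f with
  | zero => simpa using hf
  | succ n ih =>
    have key := ih (fun i => a i.succ) (comp_sub_sqrt_mul_comp_add_sqrt_mem_lifts hf (a 0))
    convert key using 1
    rw [← (Fin.consEquiv fun _ : Fin (n + 1) => ℤˣ).prod_comp, Fintype.prod_prod_type,
      Finset.prod_comm]
    refine Finset.prod_congr rfl fun s _ => ?_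
    have hu : (Finset.univ : Finset ℤˣ) = {1, -1} := rfl
    rw [hu, Finset.prod_pair (by decide)]
    simp only [Fin.consEquiv, Equiv.coe_fn_mk, Fin.sum_univ_succ, Fin.cons_zero, Fin.cons_succ,
      mul_comp, comp_assoc, sub_comp, add_comp, X_comp, C_comp]
    congr 2 <;> simp <;> ring

theorem prod_X_sub_signDiff_mem_lifts {n : ℕ} (a b : Fin n → ℕ) :
    ∏ s : (Fin n → ℤˣ) × (Fin n → ℤˣ), (X - C (signDiff a b s)) ∈ lifts (Int.castRingHom ℝ) := by
  have hX : (X : ℝ[X]) ∈ lifts (Int.castRingHom ℝ) := (mem_lifts _).2 ⟨X, by simp⟩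
  have key := prod_comp_sqrt_mem_lifts b (prod_comp_sqrt_mem_lifts a hX)
  convert key using 1
  -- The second factor runs over all signs, so its sign may be reversed.
  rw [Fintype.prod_prod_type, Finset.prod_comm, ← Equiv.prod_comp (Equiv.neg (Fin n → ℤˣ))]
  refine Finset.prod_congr rfl fun t _ => ?_
  rw [Polynomial.prod_comp]
  refine Finset.prod_congr rfl fun s _ => ?_
  simp [signDiff, sub_sub, add_comm]

/-! ### Size of the signed differences -/

open Classical in
/-- The product of the nonzero signed differences is, up to sign, the lowest nonzero coefficient of an
integral polynomial. -/
theorem one_le_prod_abs_signDiff {n : ℕ} (a b : Fin n → ℕ) :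
    1 ≤ ∏ s : (Fin n → ℤˣ) × (Fin n → ℤˣ) with signDiff a b s ≠ 0, |signDiff a b s| := by
  have hlift := prod_X_sub_signDiff_mem_lifts a b
  set m := (Finset.univ.filter fun s => ¬ signDiff a b s ≠ 0).card with hm
  set G : ℝ[X] := ∏ s : (Fin n → ℤˣ) × (Fin n → ℤˣ) with signDiff a b s ≠ 0,
    (X - C (signDiff a b s)) with hG
  have hsplit : ∏ s : (Fin n → ℤˣ) × (Fin n → ℤˣ), (X - C (signDiff a b s)) = G * X ^ m := by
    rw [← Finset.prod_filter_mul_prod_filter_not _ (fun s => signDiff a b s ≠ 0), hm]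
    congr 1
    refine Finset.prod_eq_pow_card fun s hs => ?_
    rw [not_not.1 (Finset.mem_filter.1 hs).2]
    simp
  obtain ⟨g, hg⟩ := (mem_lifts _).1 hlift
  have hcoeff : ((g.coeff m : ℤ) : ℝ) =
      ∏ s : (Fin n → ℤˣ) × (Fin n → ℤˣ) with signDiff a b s ≠ 0, (-signDiff a b s) := by
    have h : (g.map (Int.castRingHom ℝ)).coeff m = (G * X ^ m).coeff (0 + m) := by
      rw [hg, hsplit, zero_add]
    rw [coeff_mul_X_pow, coeff_map, coeff_zero_eq_eval_zero, hG, eval_prod] at h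
    simpa using h
  have habs : |((g.coeff m : ℤ) : ℝ)| =
      ∏ s : (Fin n → ℤˣ) × (Fin n → ℤˣ) with signDiff a b s ≠ 0, |signDiff a b s| := by
    rw [hcoeff, Finset.abs_prod]
    simp
  have hne : g.coeff m ≠ 0 := by
    intro h0
    rw [h0] at habs
    refine (Finset.prod_pos fun s hs => ?_).ne (by simpa using habs)
    exact abs_pos.2 (Finset.mem_filter.1 hs).2
  rw [← habs]
  exact_mod_cast Int.one_le_abs hne

theorem abs_signDiff_le {n τ : ℕ} {a b : Fin n → ℕ} (hn : 1 ≤ n)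
    (ha : ∀ i, a i ≤ 2 ^ τ) (hb : ∀ i, b i ≤ 2 ^ τ) (s : (Fin n → ℤˣ) × (Fin n → ℤˣ)) :
    |signDiff a b s| ≤ 2 ^ (n + τ) := by
  have hsum : ∀ (c : Fin n → ℕ) (u : Fin n → ℤˣ), (∀ i, c i ≤ 2 ^ τ) →
      |∑ i, ((u i : ℤ) : ℝ) * √(c i : ℝ)| ≤ n * 2 ^ τ := by
    intro c u hc
    have hterm : ∀ i ∈ Finset.univ, |((u i : ℤ) : ℝ) * √(c i : ℝ)| ≤ (2 : ℝ) ^ τ := by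
      intro i _
      have hu : |((u i : ℤ) : ℝ)| = 1 := by
        rcases Int.units_eq_one_or (u i) with h | h <;> simp [h]
      have h1 : (1 : ℝ) ≤ 2 ^ τ := one_le_pow₀ (by norm_num)
      rw [abs_mul, hu, one_mul, abs_of_nonneg (Real.sqrt_nonneg _),
        Real.sqrt_le_left (by positivity)]
      calc (c i : ℝ) ≤ 2 ^ τ := by exact_mod_cast hc i
        _ ≤ (2 ^ τ) ^ 2 := le_self_pow₀ h1 (by norm_num)
    calc _ ≤ ∑ i, |((u i : ℤ) : ℝ) * √(c i : ℝ)| := Finset.abs_sum_le_sum_abs _ _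
      _ ≤ _ := (Finset.sum_le_card_nsmul _ _ _ hterm).trans (by simp)
  have h2n : 2 * n ≤ 2 ^ n := by
    induction n, hn using Nat.le_induction with
    | base => norm_num
    | succ k hk _ =>
      have : 2 ≤ 2 ^ k := by simpa using Nat.pow_le_pow_right (n := 2) (by norm_num) hk
      have hk' : k < 2 ^ k := Nat.lt_two_pow_self
      rw [pow_succ]
      omega
  have h2n' : (2 : ℝ) * n ≤ 2 ^ n := by exact_mod_cast h2n
  calc |signDiff a b s| ≤ n * 2 ^ τ + n * 2 ^ τ :=
        (abs_sub _ _).trans (add_le_add (hsum a s.1 ha) (hsum b s.2 hb))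
    _ = (2 * n) * 2 ^ τ := by ring
    _ ≤ 2 ^ n * 2 ^ τ := by gcongr
    _ = 2 ^ (n + τ) := (pow_add _ _ _).symm

/-! ### Sums of logarithms -/

theorem signLogSum_le {n τ : ℕ} {a b : Fin n → ℕ} (hn : 1 ≤ n) (hτ : 1 ≤ τ)
    (ha : ∀ i, a i ≤ 2 ^ τ) (hb : ∀ i, b i ≤ 2 ^ τ) :
    signLogSum a b ≤ softBound 4 0 n τ := by
  classical
  set U : ℝ := (n : ℝ) + τ with hU
  have hU0 : 0 ≤ U := by positivity
  set S := Finset.univ.filter fun s : (Fin n → ℤˣ) × (Fin n → ℤˣ) => signDiff a b s ≠ 0 with hS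
  have hmem : ∀ s ∈ S, signDiff a b s ≠ 0 := fun s hs => (Finset.mem_filter.1 hs).2
  have hterm : ∀ s ∈ S, |Real.logb 2 (|signDiff a b s|)| ≤
      2 * U - Real.logb 2 (|signDiff a b s|) := by
    intro s hs
    have hL : Real.logb 2 (|signDiff a b s|) ≤ U := by
      rw [Real.logb_le_iff_le_rpow (by norm_num) (abs_pos.2 (hmem s hs)), hU]
      exact_mod_cast abs_signDiff_le hn ha hb s
    rw [abs_le]
    constructor <;> linarith
  have hlog : 0 ≤ ∑ s ∈ S, Real.logb 2 (|signDiff a b s|) := by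
    rw [← Real.logb_prod _ _ fun s hs => abs_ne_zero.2 (hmem s hs)]
    exact Real.logb_nonneg (by norm_num) (one_le_prod_abs_signDiff a b)
  have hcard : (S.card : ℝ) ≤ 2 ^ (2 * n) := by
    have h : S.card ≤ 2 ^ (2 * n) := by
      refine (Finset.card_le_univ S).trans_eq ?_
      simp [two_mul, pow_add]
    exact_mod_cast h
  have hn' : (1 : ℝ) ≤ n := by exact_mod_cast hn
  have hτ' : (1 : ℝ) ≤ τ := by exact_mod_cast hτ
  calc signLogSum a b = ∑ s ∈ S, |Real.logb 2 (|signDiff a b s|)| := by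
        rw [signLogSum]
    _ ≤ ∑ s ∈ S, (2 * U - Real.logb 2 (|signDiff a b s|)) := Finset.sum_le_sum hterm
    _ ≤ S.card * (2 * U) := by
        rw [Finset.sum_sub_distrib, Finset.sum_const, nsmul_eq_mul]
        linarith
    _ ≤ 2 ^ (2 * n) * (2 * (2 * (n * τ))) := by
        gcongr
        -- `n + τ ≤ 2 n τ` because `n, τ ≥ 1`.
        nlinarith
    _ = softBound 4 0 n τ := by rw [softBound]; ring

theorem exists_unit_mul_sqrt_of_sq_eq {w : ℂ} {c : ℕ} (h : w ^ 2 = (c : ℂ)) :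
    ∃ u : ℤˣ, w = (((u : ℤ) : ℝ) * √(c : ℝ) : ℝ) := by
  have hs : w ^ 2 = ((√(c : ℝ) : ℝ) : ℂ) ^ 2 := by
    rw [h, ← Complex.ofReal_pow, Real.sq_sqrt (Nat.cast_nonneg c), Complex.ofReal_natCast]
  rcases sq_eq_sq_iff_eq_or_eq_neg.1 hs with h | h
  · exact ⟨1, by simp [h]⟩
  · exact ⟨-1, by simp [h]⟩

theorem varietyLogSum_le_signLogSum {n : ℕ} (a b : Fin n → ℕ) :
    varietyLogSum a b ≤ signLogSum a b := by
  classical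
  -- The map from choices of signs onto the variety.
  set p : (Fin n → ℤˣ) × (Fin n → ℤˣ) → (Fin n ⊕ Fin n → ℂ) := fun s =>
    Sum.elim (fun i => ((((s.1 i : ℤ) : ℝ) * √(a i : ℝ) : ℝ) : ℂ))
      (fun i => ((((s.2 i : ℤ) : ℝ) * √(b i : ℝ) : ℝ) : ℂ)) with hp
  have hdiff : ∀ s, diffAt (p s) = (signDiff a b s : ℂ) := by
    intro s
    simp [hp, diffAt, signDiff]
  have hsurj : ∀ z ∈ sqVariety a b, ∃ s, p s = z := by
    intro z hz
    obtain ⟨h1, h2⟩ := mem_sqVariety.1 hz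
    choose u hu using fun i => exists_unit_mul_sqrt_of_sq_eq (h1 i)
    choose v hv using fun i => exists_unit_mul_sqrt_of_sq_eq (h2 i)
    refine ⟨(u, v), funext ?_⟩
    rintro (i | i)
    · exact (hu i).symm
    · exact (hv i).symm
  rw [varietyLogSum, signLogSum]
  calc _ ≤ ∑ z ∈ (Finset.univ.filter fun s => signDiff a b s ≠ 0).image p,
        |Real.logb 2 ‖diffAt z‖| := by
        refine Finset.sum_le_sum_of_subset_of_nonneg ?_ fun _ _ _ => abs_nonneg _
        intro z hz
        obtain ⟨hz, hne⟩ := Finset.mem_filter.1 hz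
        obtain ⟨s, rfl⟩ := hsurj z ((Set.Finite.mem_toFinset _).1 hz)
        refine Finset.mem_image_of_mem _ (Finset.mem_filter.2 ⟨Finset.mem_univ _, ?_⟩)
        rw [hdiff] at hne
        exact_mod_cast hne
    _ ≤ ∑ s : (Fin n → ℤˣ) × (Fin n → ℤˣ) with signDiff a b s ≠ 0,
        |Real.logb 2 ‖diffAt (p s)‖| :=
        Finset.sum_image_le_of_nonneg fun _ _ => abs_nonneg _
    _ = _ := by
        refine Finset.sum_congr rfl fun s _ => ?_
        rw [hdiff, Complex.norm_real, Real.norm_eq_abs]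

/-! ### The minimum gap -/

theorem positiveGaps_finite (n τ : ℕ) : (positiveGaps n τ).Finite := by
  have hfin : {c : Fin n → ℕ | ∀ i, c i ≤ 2 ^ τ}.Finite :=
    Set.Finite.pi' fun _ => Set.finite_Iic _
  refine ((hfin.prod hfin).image fun c : (Fin n → ℕ) × (Fin n → ℕ) =>
    |∑ i, √(c.1 i : ℝ) - ∑ i, √(c.2 i : ℝ)|).subset ?_
  rintro d ⟨-, a, b, ha, hb, rfl⟩
  exact ⟨(a, b), ⟨ha, hb⟩, rfl⟩

theorem one_mem_positiveGaps {n : ℕ} (hn : 1 ≤ n) (τ : ℕ) : 1 ∈ positiveGaps n τ := by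
  refine ⟨one_pos, Pi.single ⟨0, hn⟩ 1, 0, fun i => ?_, fun i => by simp, ?_⟩
  · refine le_trans ?_ (Nat.one_le_two_pow (n := τ))
    by_cases h : i = ⟨0, hn⟩ <;> simp [h]
  · simp [Pi.single_apply, apply_ite]

theorem isLeast_r {n : ℕ} (hn : 1 ≤ n) (τ : ℕ) : IsLeast (positiveGaps n τ) (r n τ) :=
  ⟨Set.Nonempty.csInf_mem ⟨1, one_mem_positiveGaps hn τ⟩ (positiveGaps_finite n τ),
    fun _ hd => csInf_le (positiveGaps_finite n τ).bddBelow hd⟩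

theorem abs_logb_le_signLogSum {n : ℕ} {a b : Fin n → ℕ}
    (h : 0 < |∑ i, √(a i : ℝ) - ∑ i, √(b i : ℝ)|) :
    |Real.logb 2 (|∑ i, √(a i : ℝ) - ∑ i, √(b i : ℝ)|)| ≤ signLogSum a b := by
  classical
  have h1 : signDiff a b 1 = ∑ i, √(a i : ℝ) - ∑ i, √(b i : ℝ) := by simp [signDiff]
  rw [← h1] at h ⊢
  rw [signLogSum]
  exact Finset.single_le_sum (f := fun s => |Real.logb 2 (|signDiff a b s|)|)
    (fun _ _ => abs_nonneg _) (Finset.mem_filter.2 ⟨Finset.mem_univ _, abs_pos.1 h⟩)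

end SqrtSum

theorem mainTheorem4 :
    ∃ (C : ℝ) (k : ℕ), ∀ n τ : ℕ, 1 ≤ n → 1 ≤ τ →
      (∀ a b : Fin n → ℕ, (∀ i, a i ≤ 2 ^ τ) → (∀ i, b i ≤ 2 ^ τ) →
        SqrtSum.varietyLogSum a b ≤ SqrtSum.softBound C k n τ ∧
        SqrtSum.signLogSum a b ≤ SqrtSum.softBound C k n τ) ∧
      IsLeast (SqrtSum.positiveGaps n τ) (SqrtSum.r n τ) ∧
      |-Real.logb 2 (SqrtSum.r n τ)| ≤ SqrtSum.softBound C k n τ := by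
  refine ⟨4, 0, fun n τ hn hτ => ⟨fun a b ha hb => ?_, SqrtSum.isLeast_r hn τ, ?_⟩⟩
  · have h := SqrtSum.signLogSum_le hn hτ ha hb
    exact ⟨(SqrtSum.varietyLogSum_le_signLogSum a b).trans h, h⟩
  · obtain ⟨hpos, a, b, ha, hb, heq⟩ := (SqrtSum.isLeast_r hn τ).1
    rw [abs_neg, heq]
    exact (SqrtSum.abs_logb_le_signLogSum (heq ▸ hpos)).trans (SqrtSum.signLogSum_le hn hτ ha hb)
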